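/- For a lattice $\Lambda\subset\mathbb C$ let $\mathbb P(\Lambda)=[(\mathbb C/\Lambda)/\mathbb Z_2]$ be the complex orbifold quotient by $z\mapsto -z$, with universal covering $\pi_\Lambda:\mathbb C\to\mathbb P(\Lambda)$; its four orbifold points are the image of $\frac12\Lambda$. Let $\Lambda_0=\mathbb Z+\mathbb Z\sqrt{-1}$, and let $x_1,x_2,x_3,x_4$ be the images in $\mathbb P(\Lambda_0)$ of $0,\ \frac12,\ \frac{1+\sqrt{-1}}2,\ \frac{\sqrt{-1}}2$. Fix an integer $d\ge 1$. Let $\widetilde{\mathcal M}_{0,4,d}(1)$ be the set of all $(\Lambda,u,z_1,z_2,z_3,z_4)$, where $\Lambda\subset\mathbb C$ is a lattice, $u:\mathbb P(\Lambda)\to\mathbb P(\Lambda_0)$ is a holomorphic map of orbifolds of degree $d$, $\{z_1,z_2,z_3,z_4\}$ is the set of orbifold points of $\mathbb P(\Lambda)$, $z_1=\pi_\Lambda(0)$, $u(z_1)=x_1$, $u(z_2),u(z_3),u(z_4)\in\{x_1,x_2,x_3,x_4\}$, and at each $z_i$ the homomorphism of local groups $\mathbb Z_2\to\mathbb Z_2$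 induced by $u$ is the identity. Call $(\Lambda,u,z_i)$ and $(\Lambda',u',z_i')$ equivalent if there is a biholomorphism of orbifolds $\phi:\mathbb P(\Lambda)\to\mathbb P(\Lambda')$ with $u=u'\circ\phi$ and $\phi(z_i)=z_i'$ for all $i$, and let $\mathcal M_{0,4,d}(1)$ be the set of equivalence classes. Let $\mathcal L_d(\Lambda_0)$ be the set of subgroups $L\subset\Lambda_0$ with $L\cong\mathbb Z^2$ and $|\Lambda_0/L|=d$. Proposition. Every $u$ in $\widetilde{\mathcal M}_{0,4,d}(1)$ has a linear lifting, that is, there is $\xi\in\mathbb C$ with $u(\pi_\Lambda(w))=\pi_{\Lambda_0}(\xi w)$ for all $w\in\mathbb C$, and the image $\Lambda_u:=\xi\Lambda$ does not depend on the choice of $\xi$. The assignment $[u]\mapsto\Lambda_u$ is a well-defined map $\Theta_d:\mathcal M_{0,4,d}(1)\to\mathcal L_d(\Lambda_0)$. It is surjective and exactly $6$-to-$1$: each fibre has exactly six elements. If $\Theta_d([u])=\Theta_d([u'])$, then there are a biholomorphism of orbifolds $\psi:\mathbb P(\Lambda)\to\mathbb P(\Lambda')$ of the domains and a permutation $\tau$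 of $\{1,2,3,4\}$ with $\tau(1)=1$ such that $u=u'\circ\psi$ and $\psi(z_i)=z'_{\tau(i)}$ for all $i$. Moreover, the group $S_3$ of permutations of $\{2,3,4\}$ acts on $\mathcal M_{0,4,d}(1)$ by permuting the markings $z_2,z_3,z_4$; this action preserves the fibres of $\Theta_d$ and is simply transitive on each fibre. -/

import Mathlib

open Topology

noncomputable section

namespace Pillowcase

/-! ### The orbifold `[E_Λ / ℤ₂]` with `E_Λ = ℂ / Λ` -/

/-- The underlying space of the orbifold `[E_Λ / ℤ₂]`, where `E_Λ = ℂ / Λ` and `ℤ₂ = ℤˣ = {1, -1}`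
acts by `z ↦ -z`. -/
abbrev Pillow (Λ : Submodule ℤ ℂ) : Type :=
  MulAction.orbitRel.Quotient ℤˣ (ℂ ⧸ Λ)

/-- The orbifold universal covering `ℂ → E_Λ → [E_Λ / ℤ₂]`. -/
def proj (Λ : Submodule ℤ ℂ) (z : ℂ) : Pillow Λ :=
  Quotient.mk (MulAction.orbitRel ℤˣ (ℂ ⧸ Λ)) (Submodule.Quotient.mk z)

theorem proj_eq_iff {Λ : Submodule ℤ ℂ} {z w : ℂ} :
    proj Λ z = proj Λ w ↔ z - w ∈ Λ ∨ z + w ∈ Λ := by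
  unfold proj
  rw [Quotient.eq, MulAction.orbitRel_apply, MulAction.mem_orbit_iff]
  have h1 : (Submodule.Quotient.mk w : ℂ ⧸ Λ) = Submodule.Quotient.mk z ↔ z - w ∈ Λ := by
    rw [eq_comm, Submodule.Quotient.eq]
  have h2 : -(Submodule.Quotient.mk w : ℂ ⧸ Λ) = Submodule.Quotient.mk z ↔ z + w ∈ Λ := by
    rw [eq_comm, ← Submodule.Quotient.mk_neg, Submodule.Quotient.eq, sub_neg_eq_add]
  constructor
  · rintro ⟨ε, h⟩
    rcases Int.units_eq_one_or ε with rfl | rfl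
    · exact Or.inl (h1.1 (by simpa using h))
    · exact Or.inr (h2.1 (by simpa [Units.smul_def] using h))
  · rintro (h | h)
    · exact ⟨1, by simpa using h1.2 h⟩
    · exact ⟨-1, by simpa [Units.smul_def] using h2.2 h⟩

/-- The local group of `[E_Λ / ℤ₂]` at the image of `z`: the stabilizer of `z mod Λ` in `ℤ₂`.
A uniformizing chart of the orbifold at the image of `z` is `t ↦ proj Λ (z + t)` for small `t`, on
which the local group acts linearly, by `t ↦ ε • t`. -/
abbrev localGroup (Λ : Submodule ℤ ℂ) (z : ℂ) : Subgroup ℤˣ :=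
  MulAction.stabilizer ℤˣ (Submodule.Quotient.mk z : ℂ ⧸ Λ)

/-- `f` is a holomorphic local lifting of `u`, from the uniformizing chart centred at `z` to the one
centred at `c`, and it is equivariant with respect to the homomorphism `ρ` of local groups. -/
structure IsLocalLifting {Λ Λ' : Submodule ℤ ℂ} (u : Pillow Λ → Pillow Λ') (z c : ℂ)
    (f : ℂ → ℂ) (ρ : localGroup Λ z →* localGroup Λ' c) : Prop where
  map_zero : f 0 = 0
  analyticAt : AnalyticAt ℂ f 0
  lifts : ∀ᶠ t in 𝓝 (0 : ℂ), u (proj Λ (z + t)) = proj Λ' (c + f t)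
  equivariant : ∀ ε : localGroup Λ z, ∀ᶠ t in 𝓝 (0 : ℂ),
    f ((ε : ℤˣ) • t) = (ρ ε : ℤˣ) • f t

/-- A holomorphic map of orbifolds: it has holomorphic equivariant local liftings at all points.
(Continuity follows.) -/
def IsHolomorphic {Λ Λ' : Submodule ℤ ℂ} (u : Pillow Λ → Pillow Λ') : Prop :=
  ∀ z : ℂ, ∃ (c : ℂ) (f : ℂ → ℂ) (ρ : localGroup Λ z →* localGroup Λ' c),
    IsLocalLifting u z c f ρ

/-- The compatibility condition on an orbifold stable map at a point `x` of the domain: the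
homomorphism of local groups that belongs to the local lifting at `x` is injective. At an orbifold
point with group `ℤ₂` which is mapped to an orbifold point with group `ℤ₂`, it says that this
homomorphism is the identity of `ℤ₂`. -/
def IsInjectiveOnLocalGroup {Λ Λ' : Submodule ℤ ℂ} (u : Pillow Λ → Pillow Λ')
    (x : Pillow Λ) : Prop :=
  ∀ z : ℂ, proj Λ z = x → ∃ (c : ℂ) (f : ℂ → ℂ) (ρ : localGroup Λ z →* localGroup Λ' c),
    IsLocalLifting u z c f ρ ∧ Function.Injective ρ

/-- `u` has degree `d`: the fibre over every point outside a finite set has exactly `d` points. -/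
def HasDegree {Λ Λ' : Submodule ℤ ℂ} (u : Pillow Λ → Pillow Λ') (d : ℕ) : Prop :=
  {y : Pillow Λ' | (u ⁻¹' {y}).encard ≠ d}.Finite

/-- A biholomorphism of orbifolds. -/
structure Biholo (Λ Λ' : Submodule ℤ ℂ) extends Pillow Λ ≃ Pillow Λ' where
  holo : IsHolomorphic toFun
  holo_inv : IsHolomorphic invFun

theorem isHolomorphic_id (Λ : Submodule ℤ ℂ) : IsHolomorphic (id : Pillow Λ → Pillow Λ) :=
  fun z => ⟨z, id, MonoidHom.id _, rfl, analyticAt_id, by simp, by simp⟩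

theorem IsHolomorphic.comp {Λ Λ' Λ'' : Submodule ℤ ℂ} {v : Pillow Λ' → Pillow Λ''}
    {u : Pillow Λ → Pillow Λ'} (hv : IsHolomorphic v) (hu : IsHolomorphic u) :
    IsHolomorphic (v ∘ u) := by
  intro z
  obtain ⟨c, f, ρ, hf⟩ := hu z
  obtain ⟨e, g, σ, hg⟩ := hv c
  have hcont : Filter.Tendsto f (𝓝 0) (𝓝 0) := by
    simpa [ContinuousAt, hf.map_zero] using hf.analyticAt.continuousAt
  refine ⟨e, g ∘ f, σ.comp ρ, by simp [hf.map_zero, hg.map_zero], ?_, ?_, ?_⟩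
  · exact AnalyticAt.comp (by rw [hf.map_zero]; exact hg.analyticAt) hf.analyticAt
  · filter_upwards [hf.lifts, hcont.eventually hg.lifts] with t h1 h2
    simp [h1, h2]
  · intro ε
    filter_upwards [hf.equivariant ε, hcont.eventually (hg.equivariant (ρ ε))] with t h1 h2
    simp [h1, h2]

/-! ### The target -/

/-- `Λ₀ = ℤ·1 + ℤ·√-1`. -/
def Λ₀ : Submodule ℤ ℂ := Submodule.span ℤ {1, Complex.I}

/-- The orbifold points `x₁, x₂, x₃, x₄` of the target `[E_{Λ₀} / ℤ₂]` (numbered from `0`). -/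
def xPt : Fin 4 → Pillow Λ₀ :=
  ![proj Λ₀ 0, proj Λ₀ (1 / 2), proj Λ₀ ((1 + Complex.I) / 2), proj Λ₀ (Complex.I / 2)]

/-! ### The moduli spaces -/

/-- A map `u : [E_Λ / ℤ₂] → [E_{Λ₀} / ℤ₂]`, for some lattice `Λ` in `ℂ`, with four points
`z₁, z₂, z₃, z₄` (numbered from `0`) of the domain. -/
structure MarkedMap where
  Λ : Submodule ℤ ℂ
  discrete : DiscreteTopology Λ
  isZLattice : IsZLattice ℝ Λ
  u : Pillow Λ → Pillow Λ₀
  z : Fin 4 → Pillow Λ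

/-- The set of marked holomorphic orbi-spheres of degree `d` that map `zᵢ` to `x_{a i}`. -/
structure IsOrbiSphere (d : ℕ) (a : Fin 4 → Fin 4) (s : MarkedMap) : Prop where
  holo : IsHolomorphic s.u
  degree : HasDegree s.u d
  range_z : Set.range s.z = proj s.Λ '' {w : ℂ | 2 * w ∈ s.Λ}
  z_zero : s.z 0 = proj s.Λ 0
  map_z : ∀ i, s.u (s.z i) = xPt (a i)
  inj_z : ∀ i, IsInjectiveOnLocalGroup s.u (s.z i)

/-- The space of marked holomorphic orbi-spheres of degree `d` whose first insertion is at `x₁`: the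
union over `j, k, l` of those with insertions at `x₁, x_j, x_k, x_l`. -/
def PreModuli (d : ℕ) : Set MarkedMap :=
  ⋃ (j : Fin 4) (k : Fin 4) (l : Fin 4), {s | IsOrbiSphere d ![0, j, k, l] s}

/-- The equivalence of marked maps: a biholomorphism `φ` of the domains with `u = u' ∘ φ` and
`φ (zᵢ) = zᵢ'`. -/
def MarkedMap.Equivalent (s s' : MarkedMap) : Prop :=
  ∃ φ : Biholo s.Λ s'.Λ, s.u = s'.u ∘ φ.toEquiv ∧ ∀ i, φ.toEquiv (s.z i) = s'.z i

theorem MarkedMap.equivalent_equivalence : Equivalence MarkedMap.Equivalent where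
  refl s := ⟨⟨Equiv.refl _, isHolomorphic_id _, isHolomorphic_id _⟩, rfl, fun _ => rfl⟩
  symm := by
    rintro s s' ⟨φ, hu, hz⟩
    refine ⟨⟨φ.toEquiv.symm, φ.holo_inv, φ.holo⟩, ?_, fun i => ?_⟩
    · funext x
      simp [hu]
    · simp [← hz]
  trans := by
    rintro s s' s'' ⟨φ, hu, hz⟩ ⟨ψ, hu', hz'⟩
    refine ⟨⟨φ.toEquiv.trans ψ.toEquiv, ψ.holo.comp φ.holo, φ.holo_inv.comp ψ.holo_inv⟩, ?_,
      fun i => ?_⟩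
    · funext x
      simp [hu, hu']
    · simp [hz, hz']

instance preModuliSetoid (d : ℕ) : Setoid (PreModuli d) where
  r s s' := MarkedMap.Equivalent s s'
  iseqv :=
    ⟨fun s => MarkedMap.equivalent_equivalence.refl s.1,
      fun h => MarkedMap.equivalent_equivalence.symm h,
      fun h h' => MarkedMap.equivalent_equivalence.trans h h'⟩

/-- The moduli space of degree `d` holomorphic orbi-spheres with first insertion at `x₁`. (Equivalent
marked maps have the same insertions, so that this is also the union over `j, k, l` of the
quotients.) -/
def Moduli (d : ℕ) : Type := Quotient (preModuliSetoid d)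

/-- The class of a marked holomorphic orbi-sphere. -/
def Moduli.mk {d : ℕ} (s : PreModuli d) : Moduli d := Quotient.mk (preModuliSetoid d) s

/-! ### Permutations of the last three markings -/

/-- `S₃`, as the group of permutations of the four markings that fix the first one. -/
abbrev S₃ : Subgroup (Equiv.Perm (Fin 4)) := MulAction.stabilizer (Equiv.Perm (Fin 4)) (0 : Fin 4)

/-- The same map, where the point with number `i` is given the new number `τ i`. -/
def MarkedMap.relabel (τ : Equiv.Perm (Fin 4)) (s : MarkedMap) : MarkedMap :=
  { s with z := s.z ∘ τ.symm }

theorem mem_preModuli {d : ℕ} {s : MarkedMap} :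
    s ∈ PreModuli d ↔ ∃ a : Fin 4 → Fin 4, a 0 = 0 ∧ IsOrbiSphere d a s := by
  simp only [PreModuli, Set.mem_iUnion, Set.mem_ofPred_eq]
  constructor
  · rintro ⟨j, k, l, h⟩
    exact ⟨_, rfl, h⟩
  · rintro ⟨a, ha, h⟩
    refine ⟨a 1, a 2, a 3, ?_⟩
    have : a = ![0, a 1, a 2, a 3] := by
      funext i
      fin_cases i <;> simp [ha]
    rwa [← this]

theorem relabel_mem {d : ℕ} (τ : S₃) {s : MarkedMap} (hs : s ∈ PreModuli d) :
    s.relabel τ ∈ PreModuli d := by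
  rw [mem_preModuli] at hs ⊢
  obtain ⟨a, ha, h⟩ := hs
  have hτ : (τ : Equiv.Perm (Fin 4)).symm 0 = 0 := by
    rw [Equiv.symm_apply_eq]
    exact (MulAction.mem_stabilizer_iff.1 τ.2).symm
  refine ⟨a ∘ (τ : Equiv.Perm (Fin 4)).symm, by simp [hτ, ha], h.holo, h.degree, ?_, ?_,
    fun i => h.map_z _, fun i => h.inj_z _⟩
  · simpa [MarkedMap.relabel] using h.range_z
  · simpa [MarkedMap.relabel, hτ] using h.z_zero

/-- The action of `S₃` on the moduli space by domain reparametrizations that permute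
`z₂, z₃, z₄`. -/
instance (d : ℕ) : MulAction S₃ (Moduli d) where
  smul τ := Quotient.map (fun s : PreModuli d => (⟨s.1.relabel τ, relabel_mem τ s.2⟩ : PreModuli d))
    (by
      rintro s s' ⟨φ, hu, hz⟩
      exact ⟨φ, hu, fun i => hz _⟩)
  one_smul := by
    rintro ⟨s⟩
    rfl
  mul_smul := by
    rintro σ τ ⟨s⟩
    rfl

/-! ### Linear liftings and sublattices -/

/-- `w ↦ ξ w` is a lifting of `u` to the universal covers. -/
def IsLinearLifting (s : MarkedMap) (ξ : ℂ) : Prop :=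
  ∀ w : ℂ, s.u (proj s.Λ w) = proj Λ₀ (ξ * w)

/-- The sublattices `Λ ⊆ Λ₀` with `Λ ≅ ℤ²` and `|Λ₀ / Λ| = d`. -/
def Sublattices (d : ℕ) : Set (Submodule ℤ ℂ) :=
  {Λ | Λ ≤ Λ₀ ∧ Nonempty (Λ ≃ₗ[ℤ] (Fin 2 → ℤ)) ∧ Nat.card (Λ₀ ⧸ Λ.submoduleOf Λ₀) = d}

/-- `Θ` is the map `[u] ↦ Λ_u`: every `u` has a linear lifting, and `Θ [u]` is the image of the
lattice of the domain of `u` under any linear lifting of `u`. -/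
def IsTheta (d : ℕ) (Θ : Moduli d → Sublattices d) : Prop :=
  ∀ s : PreModuli d, (∃ ξ : ℂ, IsLinearLifting s.1 ξ) ∧
    ∀ ξ : ℂ, IsLinearLifting s.1 ξ →
      (Θ (Moduli.mk s) : Submodule ℤ ℂ) = s.1.Λ.map (LinearMap.mulLeft ℤ ξ)

end Pillowcase

end

namespace Pillowcase

/-! ### Local liftings and linear liftings -/

variable {Λ Λ' Λ'' : Submodule ℤ ℂ} {d : ℕ}

/-! Two local liftings of a holomorphic `u` at the same point differ by a sign, up to their base
points, because the lattice of the target is discrete. So the square of the derivative of a lifting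
is a well-defined entire function, periodic under `Λ`, hence bounded, hence constant by Liouville.
Every local lifting is therefore linear with slope `±ξ`, and a connectedness argument from `0` glues
them to `w ↦ ξ w` (`IsHolomorphic.exists_linear`).

The rest is lattice arithmetic. The slope is unique up to sign, so `ξΛ` is well defined, and the
fibre over a non-orbifold point is a copy of `Λ₀ / ξΛ`, so the degree is the index
(`IsLinear.encard_fibre`). If `ξΛ = ξ'Λ'`, multiplication by `ξ'⁻¹ξ` identifies the two maps and
carries half-lattice points to half-lattice points, fixing `0`; only the numbering of the other
three markings can differ. An automorphism of the domain over `u` that fixes the first marking is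
multiplication by `±1`, the identity of the quotient, so different numberings are inequivalent. Each
`L` occurs, through the inclusion `L ⊆ Λ₀` with `ξ = 1`. The fibres are thus free `S₃`-orbits. -/

theorem eventually_eq_of_mem (Λ : Submodule ℤ ℂ) [h : DiscreteTopology Λ] (a : ℂ) :
    ∀ᶠ x in 𝓝 a, x ∈ Λ → x = a := by
  by_cases ha : a ∈ Λ
  · have := discreteTopology_subtype_iff.1 h a ha
    have h2 : ∀ᶠ x in 𝓝[≠] a, x ∉ (Λ : Set ℂ) := by
      rw [Filter.inf_principal_eq_bot] at this
      exact this
    rw [eventually_nhdsWithin_iff] at h2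
    filter_upwards [h2] with x hx hm
    by_contra hne
    exact hx hne hm
  · have hc : IsClosed (Λ : Set ℂ) :=
      @AddSubgroup.isClosed_of_discrete _ _ _ _ _ Λ.toAddSubgroup h
    filter_upwards [hc.isOpen_compl.mem_nhds ha] with x hx hm
    exact absurd hm hx

/-- `f` is a holomorphic local lifting of `u` from the chart at `z` to the chart at `c`. -/
structure IsLift (u : Pillow Λ → Pillow Λ') (z c : ℂ) (f : ℂ → ℂ) : Prop where
  map_zero : f 0 = 0
  analyticAt : AnalyticAt ℂ f 0
  lifts : ∀ᶠ t in 𝓝 (0 : ℂ), u (proj Λ (z + t)) = proj Λ' (c + f t)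

theorem IsHolomorphic.exists_isLift {u : Pillow Λ → Pillow Λ'} (hu : IsHolomorphic u) (z : ℂ) :
    ∃ c f, IsLift u z c f := by
  obtain ⟨c, f, ρ, h⟩ := hu z
  exact ⟨c, f, h.map_zero, h.analyticAt, h.lifts⟩

theorem eventually_nhds_zero_add {p : ℂ → Prop} (hp : ∀ᶠ t in 𝓝 (0 : ℂ), p t) :
    ∀ᶠ s in 𝓝 (0 : ℂ), ∀ᶠ t in 𝓝 (0 : ℂ), p (s + t) := by
  filter_upwards [hp.eventually_nhds] with s hs
  have : Filter.Tendsto (fun t : ℂ => s + t) (𝓝 0) (𝓝 s) := by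
    simpa using (continuous_const_add s).tendsto (0 : ℂ)
  exact this.eventually hs

theorem eventually_nhds_iff_add {p : ℂ → Prop} {w : ℂ} :
    (∀ᶠ x in 𝓝 w, p x) ↔ ∀ᶠ t in 𝓝 (0 : ℂ), p (w + t) := by
  rw [← add_zero w, ← map_add_left_nhds_zero, add_zero, Filter.eventually_map]

/-- Recentring lets a single `f` provide liftings, and hence derivatives, at all points near `z`. -/
theorem IsLift.shift {u : Pillow Λ → Pillow Λ'} {z c : ℂ} {f : ℂ → ℂ} (h : IsLift u z c f) :
    ∀ᶠ s in 𝓝 (0 : ℂ), IsLift u (z + s) (c + f s) (fun t => f (s + t) - f s) := by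
  filter_upwards [eventually_nhds_zero_add h.lifts, h.analyticAt.eventually_analyticAt] with s h1 h2
  refine ⟨by simp, ?_, ?_⟩
  · refine AnalyticAt.sub (AnalyticAt.fun_comp ?_ (by fun_prop)) analyticAt_const
    simpa using h2
  · filter_upwards [h1] with t ht
    rw [add_assoc, ht]
    congr 1
    ring

/-- One of the two alternatives must hold frequently in the punctured neighbourhood; the identity
theorem then spreads it to a full neighbourhood. -/
theorem eq_or_eq_neg_of_frequently {f g : ℂ → ℂ} (hf : AnalyticAt ℂ f 0) (hg : AnalyticAt ℂ g 0)
    (h : ∀ᶠ t in 𝓝 (0 : ℂ), f t = g t ∨ f t = - g t) :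
    (∀ᶠ t in 𝓝 (0 : ℂ), f t = g t) ∨ ∀ᶠ t in 𝓝 (0 : ℂ), f t = - g t := by
  have h' : ∃ᶠ t in 𝓝[≠] (0 : ℂ), f t = g t ∨ f t = - g t :=
    (h.filter_mono nhdsWithin_le_nhds).frequently
  rw [Filter.frequently_or_distrib] at h'
  exact h'.imp (hf.frequently_eq_iff_eventually_eq hg).1
    (hf.frequently_eq_iff_eventually_eq hg.neg).1

/-- Either the difference or the sum of `c + f` and `c' + g` lies in `Λ'` and, by discreteness,
equals its value at `0`. Thus `f = ±g` near `0`, and squaring removes the sign. -/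
theorem IsLift.deriv_sq_eq [DiscreteTopology Λ'] {u : Pillow Λ → Pillow Λ'} {z c c' : ℂ}
    {f g : ℂ → ℂ} (hf : IsLift u z c f) (hg : IsLift u z c' g) :
    deriv f 0 ^ 2 = deriv g 0 ^ 2 := by
  have hsub : Filter.Tendsto (fun t => c + f t - (c' + g t)) (𝓝 0) (𝓝 (c - c')) := by
    have : ContinuousAt (fun t => c + f t - (c' + g t)) 0 :=
      (hf.analyticAt.continuousAt.const_add c).sub (hg.analyticAt.continuousAt.const_add c')
    simpa [ContinuousAt, hf.map_zero, hg.map_zero] using this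
  have hadd : Filter.Tendsto (fun t => c + f t + (c' + g t)) (𝓝 0) (𝓝 (c + c')) := by
    have : ContinuousAt (fun t => c + f t + (c' + g t)) 0 :=
      (hf.analyticAt.continuousAt.const_add c).add (hg.analyticAt.continuousAt.const_add c')
    simpa [ContinuousAt, hf.map_zero, hg.map_zero] using this
  have key : ∀ᶠ t in 𝓝 (0 : ℂ), f t = g t ∨ f t = - g t := by
    filter_upwards [hf.lifts, hg.lifts, hsub.eventually (eventually_eq_of_mem Λ' (c - c')),
      hadd.eventually (eventually_eq_of_mem Λ' (c + c'))] with t h1 h2 h3 h4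
    rw [h1] at h2
    rcases proj_eq_iff.1 h2 with h | h
    · left; linear_combination h3 h
    · right; linear_combination h4 h
  rcases eq_or_eq_neg_of_frequently hf.analyticAt hg.analyticAt key with h | h
  · rw [Filter.EventuallyEq.deriv_eq h]
  · rw [Filter.EventuallyEq.deriv_eq (f := fun t => - g t) h, deriv.fun_neg, neg_sq]

theorem proj_add_mem {l : ℂ} (hl : l ∈ Λ) (z : ℂ) : proj Λ (z + l) = proj Λ z :=
  proj_eq_iff.2 (Or.inl (by simpa using hl))

theorem proj_neg (z : ℂ) : proj Λ (-z) = proj Λ z :=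
  proj_eq_iff.2 (Or.inr (by simp))

theorem proj_surjective (x : Pillow Λ) : ∃ z, proj Λ z = x := by
  induction x using Quotient.inductionOn with
  | h x =>
    induction x using Submodule.Quotient.induction_on with
    | _ z => exact ⟨z, rfl⟩

theorem deriv_comp_const_add_sub (f : ℂ → ℂ) (s : ℂ) :
    deriv (fun t => f (s + t) - f s) 0 = deriv f s := by
  rw [deriv_sub_const, deriv_comp_const_add, add_zero]

/-- The squares of the derivatives of all local liftings are one and the same number. -/
theorem IsHolomorphic.exists_deriv_sq [DiscreteTopology Λ] [IsZLattice ℝ Λ] [DiscreteTopology Λ']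
    {u : Pillow Λ → Pillow Λ'} (hu : IsHolomorphic u) :
    ∃ ξ : ℂ, ∀ z c f, IsLift u z c f → deriv f 0 ^ 2 = ξ ^ 2 := by
  choose c f hf using hu.exists_isLift
  have hG : ∀ z, (∀ᶠ s in 𝓝 (0 : ℂ), deriv (f (z + s)) 0 ^ 2 = deriv (f z) s ^ 2) := by
    intro z
    filter_upwards [(hf z).shift] with s hs
    rw [(hf (z + s)).deriv_sq_eq hs, deriv_comp_const_add_sub]
  have hdiff : Differentiable ℂ (fun z => deriv (f z) 0 ^ 2) := by
    intro z
    have h1 : DifferentiableAt ℂ (fun x => deriv (f z) (x - z) ^ 2) z := by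
      have h0 : DifferentiableAt ℂ (deriv (f z)) (z - z) := by
        simpa using (hf z).analyticAt.deriv.differentiableAt
      exact (h0.comp (f := fun x => x - z) z (differentiableAt_id.sub_const z)).pow 2
    refine h1.congr_of_eventuallyEq ?_
    rw [Filter.EventuallyEq, eventually_nhds_iff_add]
    filter_upwards [hG z] with s hs
    simpa using hs
  have hper : ∀ z w, w ∈ Λ → deriv (f (z + w)) 0 ^ 2 = deriv (f z) 0 ^ 2 := by
    intro z w hw
    have : IsLift u (z + w) (c z) (f z) := by
      refine ⟨(hf z).map_zero, (hf z).analyticAt, ?_⟩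
      filter_upwards [(hf z).lifts] with t ht
      rw [← ht, add_right_comm, proj_add_mem hw]
    exact (hf (z + w)).deriv_sq_eq this
  have hb := (IsZLattice.isCompact_range_of_periodic Λ _ hdiff.continuous hper).isBounded
  refine ⟨deriv (f 0) 0, fun z e g hg => ?_⟩
  rw [hg.deriv_sq_eq (hf z)]
  -- Liouville's theorem; boundedness came from periodicity under a lattice of full rank.
  exact hdiff.apply_eq_apply_of_bounded hb z 0

/-- The derivative of a lifting takes only the values `±ξ`, and the identity theorem fixes one sign.
Slope `-ξ` is turned into `ξ` by replacing `c` with `-c`, since `proj` is even. -/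
theorem IsHolomorphic.exists_local_linear [DiscreteTopology Λ] [IsZLattice ℝ Λ]
    [DiscreteTopology Λ'] {u : Pillow Λ → Pillow Λ'} (hu : IsHolomorphic u) :
    ∃ ξ : ℂ, ∀ z, ∃ c, ∀ᶠ x in 𝓝 z, u (proj Λ x) = proj Λ' (c + ξ * (x - z)) := by
  obtain ⟨ξ, hξ⟩ := hu.exists_deriv_sq
  refine ⟨ξ, fun z => ?_⟩
  obtain ⟨c, f, hf⟩ := hu.exists_isLift z
  have hd : ∀ᶠ s in 𝓝 (0 : ℂ), deriv f s = ξ ∨ deriv f s = -ξ := by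
    filter_upwards [hf.shift] with s hs
    have := hξ _ _ _ hs
    rwa [deriv_comp_const_add_sub, sq_eq_sq_iff_eq_or_eq_neg] at this
  have lin : ∀ η : ℂ, (∀ᶠ s in 𝓝 (0 : ℂ), deriv f s = η) → ∀ᶠ s in 𝓝 (0 : ℂ), f s = η * s := by
    intro η hη
    obtain ⟨r, hr, hball⟩ := Metric.eventually_nhds_iff_ball.1
      (hη.and (hf.analyticAt.eventually_analyticAt))
    filter_upwards [Metric.ball_mem_nhds (0 : ℂ) hr] with s hs
    have hdf : ∀ y ∈ Metric.ball (0 : ℂ) r, HasDerivAt (fun x => f x - η * x) 0 y := by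
      intro y hy
      have h1 := (hball y hy).2.differentiableAt.hasDerivAt
      rw [(hball y hy).1] at h1
      simpa using h1.fun_sub ((hasDerivAt_id y).const_mul η)
    have := (convex_ball (0 : ℂ) r).is_const_of_fderivWithin_eq_zero (𝕜 := ℂ)
      (f := fun x => f x - η * x)
      (fun y hy => (hdf y hy).differentiableAt.differentiableWithinAt)
      (fun y hy => by
        rw [fderivWithin_of_isOpen Metric.isOpen_ball hy]
        ext
        simpa using (hdf y hy).deriv)
      hs (Metric.mem_ball_self hr)
    simpa [hf.map_zero, sub_eq_zero] using this
  simp only [eventually_nhds_iff_add (w := z), add_sub_cancel_left]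
  rcases eq_or_eq_neg_of_frequently hf.analyticAt.deriv analyticAt_const hd with h | h
  · refine ⟨c, ?_⟩
    filter_upwards [hf.lifts, lin _ h] with t h1 h2
    rw [h1, h2]
  · refine ⟨-c, ?_⟩
    filter_upwards [hf.lifts, lin _ h] with t h1 h2
    rw [h1, h2, ← proj_neg]
    congr 1
    ring

/-- A holomorphic map of orbifolds that maps `proj Λ 0` to `proj Λ' 0` has a linear lifting. -/
theorem IsHolomorphic.exists_linear [DiscreteTopology Λ] [IsZLattice ℝ Λ]
    [DiscreteTopology Λ'] {u : Pillow Λ → Pillow Λ'} (hu : IsHolomorphic u)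
    (h0 : u (proj Λ 0) = proj Λ' 0) :
    ∃ ξ : ℂ, ∀ w, u (proj Λ w) = proj Λ' (ξ * w) := by
  obtain ⟨ξ, hξ⟩ := hu.exists_local_linear
  refine ⟨ξ, ?_⟩
  have hext : ∀ (w c : ℂ), c - ξ * w ∈ Λ' →
      ∀ x, proj Λ' (c + ξ * (x - w)) = proj Λ' (ξ * x) := by
    intro w c hc x
    rw [← proj_add_mem hc (ξ * x)]
    congr 1
    ring
  -- `S` is shown to be clopen and to contain `0`.
  let S : Set ℂ := {w | ∀ᶠ x in 𝓝 w, u (proj Λ x) = proj Λ' (ξ * x)}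
  have hopen : IsOpen S := isOpen_setOfPred_eventually_nhds
  have hclosed : IsClosed S := by
    refine isClosed_of_closure_subset fun w hw => ?_
    obtain ⟨c, hc⟩ := hξ w
    have hc' := hc.eventually_nhds
    obtain ⟨x₀, hx₀, hx₀S⟩ := mem_closure_iff_nhds.1 hw _ hc'
    suffices hmem : c - ξ * w ∈ Λ' by
      filter_upwards [hc] with x hx
      rw [hx, hext w c hmem]
    -- Near a point of `S` close to `w`, only the sum alternative of `proj_eq_iff` is left, so `c -
    -- ξw + 2ξx` stays in `Λ'` for all nearby `x`. Discreteness makes `ξx` locally constant, so `ξ =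
    -- 0`, and then the same membership says `c - ξw ∈ Λ'`.
    by_contra hmem
    have hev : ∀ᶠ x in 𝓝 x₀, c - ξ * w + 2 * (ξ * x) ∈ Λ' := by
      filter_upwards [hx₀, hx₀S] with x h1 h2
      rw [h1] at h2
      rcases proj_eq_iff.1 h2 with h | h
      · exact absurd (by convert h using 1; ring) hmem
      · convert h using 1; ring
    have hcont : Filter.Tendsto (fun x => c - ξ * w + 2 * (ξ * x)) (𝓝 x₀)
        (𝓝 (c - ξ * w + 2 * (ξ * x₀))) := Continuous.tendsto (by fun_prop) _
    have hev2 : ∀ᶠ x in 𝓝[≠] x₀, x ∈ ({x₀} : Set ℂ)ᶜ ∧ ξ * x = ξ * x₀ := by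
      refine eventually_mem_nhdsWithin.and (Filter.Eventually.filter_mono nhdsWithin_le_nhds ?_)
      filter_upwards [hev, hcont.eventually (eventually_eq_of_mem Λ' _)] with x h1 h2
      linear_combination (h2 h1) / 2
    obtain ⟨x, hx, hxe⟩ := hev2.exists
    have hξ0 : ξ = 0 := by
      by_contra h
      exact hx (mul_left_cancel₀ h hxe)
    apply hmem
    simpa [hξ0] using hev.self_of_nhds
  have hne : (0 : ℂ) ∈ S := by
    obtain ⟨c, hc⟩ := hξ 0
    have h1 : c ∈ Λ' := by
      have := hc.self_of_nhds
      rw [h0] at this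
      simpa [proj_eq_iff] using this
    filter_upwards [hc] with x hx
    rw [hx, hext 0 c (by simpa using h1)]
  have hS : S = Set.univ := IsClopen.eq_univ ⟨hclosed, hopen⟩ ⟨0, hne⟩
  intro w
  have hw : ∀ᶠ x in 𝓝 w, u (proj Λ x) = proj Λ' (ξ * x) := hS.ge (Set.mem_univ w)
  exact hw.self_of_nhds

/-! ### Maps with a linear lifting -/

/-- `w ↦ ξ w` is a lifting of `u` to the universal covers. -/
def IsLinear (u : Pillow Λ → Pillow Λ') (ξ : ℂ) : Prop :=
  ∀ w : ℂ, u (proj Λ w) = proj Λ' (ξ * w)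

/-- A single nonzero `w` suffices, so small that `(a - b)w` and `(a + b)w` can lie in `Λ` only by
vanishing. -/
theorem eq_or_eq_neg_of_proj_mul [DiscreteTopology Λ] {a b : ℂ}
    (h : ∀ w, proj Λ (a * w) = proj Λ (b * w)) : a = b ∨ a = -b := by
  have t1 : Filter.Tendsto (fun w => a * w - b * w) (𝓝 0) (𝓝 0) := by
    simpa using (show Continuous fun w : ℂ => a * w - b * w by fun_prop).tendsto 0
  have t2 : Filter.Tendsto (fun w => a * w + b * w) (𝓝 0) (𝓝 0) := by
    simpa using (show Continuous fun w : ℂ => a * w + b * w by fun_prop).tendsto 0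
  have hev := ((t1.eventually (eventually_eq_of_mem Λ 0)).and
    (t2.eventually (eventually_eq_of_mem Λ 0))).filter_mono
    (nhdsWithin_le_nhds (s := ({0} : Set ℂ)ᶜ))
  obtain ⟨w, ⟨h1, h2⟩, hw⟩ := (hev.and eventually_mem_nhdsWithin).exists
  rcases proj_eq_iff.1 (h w) with h | h
  · left
    refine mul_right_cancel₀ hw ?_
    linear_combination h1 h
  · right
    refine mul_right_cancel₀ hw ?_
    linear_combination h2 h

theorem IsLinear.comp {v : Pillow Λ' → Pillow Λ''} {u : Pillow Λ → Pillow Λ'} {ξ η : ℂ}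
    (hv : IsLinear v η) (hu : IsLinear u ξ) : IsLinear (v ∘ u) (η * ξ) := fun w => by
  rw [Function.comp_apply, hu, hv, mul_assoc]

theorem map_mulLeft_le_iff {ξ : ℂ} :
    Λ.map (LinearMap.mulLeft ℤ ξ) ≤ Λ' ↔ ∀ l ∈ Λ, ξ * l ∈ Λ' := by
  simp [SetLike.le_def]

theorem mem_map_mulLeft_iff {ξ l : ℂ} (hξ : ξ ≠ 0) :
    l ∈ Λ.map (LinearMap.mulLeft ℤ ξ) ↔ ξ⁻¹ * l ∈ Λ := by
  rw [Submodule.mem_map]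
  constructor
  · rintro ⟨m, hm, rfl⟩
    simpa [hξ] using hm
  · intro h
    exact ⟨_, h, by simp [hξ]⟩

theorem map_mulLeft_map (a b : ℂ) :
    (Λ.map (LinearMap.mulLeft ℤ a)).map (LinearMap.mulLeft ℤ b) =
      Λ.map (LinearMap.mulLeft ℤ (b * a)) := by
  rw [← Submodule.map_comp, LinearMap.mulLeft_mul]

theorem map_mulLeft_one : Λ.map (LinearMap.mulLeft ℤ (1 : ℂ)) = Λ := by
  simp

theorem map_mulLeft_neg (ξ : ℂ) :
    Λ.map (LinearMap.mulLeft ℤ (-ξ)) = Λ.map (LinearMap.mulLeft ℤ ξ) := by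
  ext x
  simp only [Submodule.mem_map, LinearMap.mulLeft_apply]
  exact ⟨fun ⟨y, hy, h⟩ => ⟨-y, neg_mem hy, by simpa using h⟩,
    fun ⟨y, hy, h⟩ => ⟨-y, neg_mem hy, by simpa using h⟩⟩

theorem IsLinear.map_le {u : Pillow Λ → Pillow Λ'} {ξ : ℂ} (hu : IsLinear u ξ) :
    Λ.map (LinearMap.mulLeft ℤ ξ) ≤ Λ' := by
  rw [map_mulLeft_le_iff]
  intro l hl
  have h0 : proj Λ l = proj Λ 0 := proj_eq_iff.2 (Or.inl (by simpa using hl))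
  have h := hu l
  rw [h0, hu 0, eq_comm] at h
  simpa [proj_eq_iff] using h

/-- The map of orbifolds with lifting `w ↦ ξ w`. -/
noncomputable def linearMap (Λ Λ' : Submodule ℤ ℂ) (ξ : ℂ) (x : Pillow Λ) : Pillow Λ' :=
  proj Λ' (ξ * (proj_surjective x).choose)

theorem isLinear_linearMap {ξ : ℂ} (h : Λ.map (LinearMap.mulLeft ℤ ξ) ≤ Λ') :
    IsLinear (linearMap Λ Λ' ξ) ξ := by
  intro w
  rw [map_mulLeft_le_iff] at h
  refine proj_eq_iff.2 ?_
  rcases proj_eq_iff.1 (proj_surjective (proj Λ w)).choose_spec with h1 | h1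
  · left; simpa [mul_sub] using h _ h1
  · right; simpa [mul_add] using h _ h1

theorem mem_localGroup_iff {z : ℂ} {ε : ℤˣ} : ε ∈ localGroup Λ z ↔ ε • z - z ∈ Λ := by
  rw [MulAction.mem_stabilizer_iff, Units.smul_def, Units.smul_def, ← Submodule.Quotient.mk_smul,
    Submodule.Quotient.eq]

theorem IsLinear.localGroup_le {u : Pillow Λ → Pillow Λ'} {ξ : ℂ} (hu : IsLinear u ξ) (z : ℂ) :
    localGroup Λ z ≤ localGroup Λ' (ξ * z) := by
  intro ε hε
  rw [mem_localGroup_iff] at hε ⊢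
  have := map_mulLeft_le_iff.1 hu.map_le _ hε
  rwa [mul_sub, mul_smul_comm] at this

/-- Multiplication by `ξ` commutes with signs, so the homomorphism of local groups is an inclusion
of subgroups of `ℤˣ`; its injectivity is the condition required at the markings. -/
theorem IsLinear.isLocalLifting {u : Pillow Λ → Pillow Λ'} {ξ : ℂ} (hu : IsLinear u ξ) (z : ℂ) :
    IsLocalLifting u z (ξ * z) (fun t => ξ * t) (Subgroup.inclusion (hu.localGroup_le z)) where
  map_zero := by simp
  analyticAt := by fun_prop
  lifts := Filter.Eventually.of_forall fun t => by rw [hu, mul_add]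
  equivariant ε := Filter.Eventually.of_forall fun t => by
    simp [mul_smul_comm]

theorem IsLinear.isHolomorphic {u : Pillow Λ → Pillow Λ'} {ξ : ℂ} (hu : IsLinear u ξ) :
    IsHolomorphic u :=
  fun z => ⟨_, _, _, hu.isLocalLifting z⟩

theorem IsLinear.isInjectiveOnLocalGroup {u : Pillow Λ → Pillow Λ'} {ξ : ℂ} (hu : IsLinear u ξ)
    (x : Pillow Λ) : IsInjectiveOnLocalGroup u x :=
  fun z _ => ⟨_, _, _, hu.isLocalLifting z, Subgroup.inclusion_injective _⟩

theorem IsLinear.eq_id {u : Pillow Λ → Pillow Λ} {ξ : ℂ} (hu : IsLinear u ξ)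
    (hξ : ξ = 1 ∨ ξ = -1) : u = id := by
  funext x
  obtain ⟨w, rfl⟩ := proj_surjective x
  rcases hξ with rfl | rfl <;> simp [hu w, proj_neg]

/-- Multiplication by `ξ` as a biholomorphism of orbifolds. -/
noncomputable def Biholo.ofLinear {ξ : ℂ} (hξ : ξ ≠ 0)
    (h : Λ.map (LinearMap.mulLeft ℤ ξ) = Λ') : Biholo Λ Λ' :=
  have h1 : IsLinear (linearMap Λ Λ' ξ) ξ := isLinear_linearMap h.le
  have h2 : IsLinear (linearMap Λ' Λ ξ⁻¹) ξ⁻¹ := isLinear_linearMap (by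
    rw [← h, map_mulLeft_map, inv_mul_cancel₀ hξ, map_mulLeft_one])
  { toFun := linearMap Λ Λ' ξ
    invFun := linearMap Λ' Λ ξ⁻¹
    left_inv := congrFun ((h2.comp h1).eq_id (Or.inl (inv_mul_cancel₀ hξ)))
    right_inv := congrFun ((h1.comp h2).eq_id (Or.inl (mul_inv_cancel₀ hξ)))
    holo := h1.isHolomorphic
    holo_inv := h2.isHolomorphic }

theorem Biholo.isLinear_ofLinear {ξ : ℂ} (hξ : ξ ≠ 0) (h : Λ.map (LinearMap.mulLeft ℤ ξ) = Λ') :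
    IsLinear (Biholo.ofLinear hξ h).toEquiv ξ :=
  isLinear_linearMap h.le

/-- The slopes `η`, `θ` of `φ` and its inverse satisfy `ηθ = ±1`, so `θΛ' ⊆ Λ` yields `Λ' ⊆ ηΛ`. -/
theorem Biholo.exists_linear [DiscreteTopology Λ] [IsZLattice ℝ Λ] [DiscreteTopology Λ']
    [IsZLattice ℝ Λ'] (φ : Biholo Λ Λ') (h0 : φ.toEquiv (proj Λ 0) = proj Λ' 0) :
    ∃ η : ℂ, IsLinear φ.toEquiv η ∧ Λ.map (LinearMap.mulLeft ℤ η) = Λ' := by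
  obtain ⟨η, hη⟩ := φ.holo.exists_linear h0
  obtain ⟨θ, hθ⟩ := φ.holo_inv.exists_linear (φ.toEquiv.symm_apply_eq.2 h0.symm)
  have hη : IsLinear φ.toEquiv η := hη
  have hθ : IsLinear φ.toEquiv.symm θ := hθ
  refine ⟨η, hη, le_antisymm hη.map_le ?_⟩
  have hc := hη.comp hθ
  have h1 : η * θ = 1 ∨ η * θ = -1 := eq_or_eq_neg_of_proj_mul (Λ := Λ') fun w => by
    rw [← hc w]
    simp
  have h2 := Submodule.map_mono (f := LinearMap.mulLeft ℤ η) hθ.map_le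
  rw [map_mulLeft_map] at h2
  rcases h1 with h1 | h1
  · rwa [h1, map_mulLeft_one] at h2
  · rwa [h1, map_mulLeft_neg, map_mulLeft_one] at h2

/-! ### The degree -/

/-- Up to sign, every preimage has a representative `ξ⁻¹(c + l)` with `l ∈ Λ'`, and `l` matters only
modulo `ξΛ`. The involution identifies no further pairs: that would put `2c + l + l'`, hence `2c`,
in `Λ'`. -/
theorem IsLinear.encard_fibre {u : Pillow Λ → Pillow Λ'} {ξ : ℂ} (hu : IsLinear u ξ) (hξ : ξ ≠ 0)
    {c : ℂ} (hc : 2 * c ∉ Λ') :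
    (u ⁻¹' {proj Λ' c}).encard =
      ENat.card (Λ' ⧸ (Λ.map (LinearMap.mulLeft ℤ ξ)).submoduleOf Λ') := by
  set M := (Λ.map (LinearMap.mulLeft ℤ ξ)).submoduleOf Λ' with hM
  have hmem : ∀ l l' : Λ', (Submodule.Quotient.mk l : Λ' ⧸ M) = Submodule.Quotient.mk l' ↔
      proj Λ (ξ⁻¹ * (c + l)) = proj Λ (ξ⁻¹ * (c + l')) := by
    intro l l'
    rw [Submodule.Quotient.eq, hM, Submodule.submoduleOf, Submodule.mem_comap,
      Submodule.subtype_apply, mem_map_mulLeft_iff hξ, proj_eq_iff]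
    have e1 : ξ⁻¹ * ((l - l' : Λ') : ℂ) = ξ⁻¹ * (c + l) - ξ⁻¹ * (c + l') := by
      push_cast; ring
    rw [e1]
    refine ⟨Or.inl, fun h => h.resolve_right fun h' => hc ?_⟩
    have h2 := map_mulLeft_le_iff.1 hu.map_le _ h'
    have h3 := sub_mem h2 (l + l').2
    convert h3 using 1
    push_cast
    field_simp
    ring
  let g : Λ' ⧸ M → Pillow Λ := fun q => proj Λ (ξ⁻¹ * (c + (Quotient.out q : Λ')))
  have hout : ∀ q : Λ' ⧸ M, (Submodule.Quotient.mk (Quotient.out q) : Λ' ⧸ M) = q :=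
    fun q => Quotient.out_eq q
  have hg : Function.Injective g := by
    intro q q' h
    rw [← hout q, ← hout q']
    exact (hmem _ _).2 h
  have hr : Set.range g = u ⁻¹' {proj Λ' c} := by
    ext x
    constructor
    · rintro ⟨q, rfl⟩
      change u (proj Λ _) = _
      rw [hu, mul_inv_cancel_left₀ hξ]
      exact proj_add_mem (Quotient.out q : Λ').2 c
    · obtain ⟨w, rfl⟩ := proj_surjective x
      intro hx
      have key : ∀ w : ℂ, ξ * w - c ∈ Λ' → proj Λ w ∈ Set.range g := by
        intro w hw
        refine ⟨Submodule.Quotient.mk ⟨_, hw⟩, ?_⟩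
        change proj Λ _ = _
        rw [(hmem _ ⟨_, hw⟩).1 (hout _)]
        congr 1
        field_simp
        ring
      have hx : u (proj Λ w) = proj Λ' c := hx
      rw [hu] at hx
      rcases proj_eq_iff.1 hx with h | h
      · exact key w h
      · rw [← proj_neg]
        refine key _ ?_
        rw [← neg_mem_iff]
        convert h using 1
        ring
  rw [← hr, ← Set.image_univ, hg.encard_image, Set.encard_univ]

theorem basisOneI_span : Submodule.span ℤ (Set.range Complex.basisOneI) = Λ₀ := by
  rw [Complex.coe_basisOneI, Matrix.range_cons, Matrix.range_cons, Matrix.range_empty,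
    Set.union_empty, Set.singleton_union, Λ₀]

instance discreteTopology_Λ₀ : DiscreteTopology Λ₀ := by
  rw [← basisOneI_span]; infer_instance

instance isZLattice_Λ₀ : IsZLattice ℝ Λ₀ where
  span_top := by
    rw [eq_top_iff, ← Complex.basisOneI.span_eq, ← basisOneI_span]
    exact Submodule.span_mono Submodule.subset_span

/-- Away from the four orbifold points there are infinitely many points. -/
theorem infinite_proj_regular : (proj Λ₀ '' {c : ℂ | 2 * c ∉ Λ₀}).Infinite := by
  have key : ∀ x : ℝ, (x : ℂ) ∈ Λ₀ → ∃ n : ℤ, x = n := by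
    intro x hx
    rw [Λ₀, Submodule.mem_span_pair] at hx
    obtain ⟨m, n, h⟩ := hx
    exact ⟨m, by simpa using (congrArg Complex.re h).symm⟩
  -- For `x`, `y` in this interval, `x - y` lies in `(-1, 1)` and `x + y` in `(0, 1)`, while the
  -- real elements of `Λ₀` are integers.
  have hinj : Set.InjOn (fun x : ℝ => proj Λ₀ x) (Set.Ioo 0 (1 / 2)) := by
    intro x hx y hy h
    simp only [Set.mem_Ioo] at hx hy
    rcases proj_eq_iff.1 h with h | h
    · obtain ⟨n, hn⟩ := key (x - y) (by push_cast; exact h)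
      have h1 : (-1 : ℝ) < n := by linarith
      have h2 : (n : ℝ) < 1 := by linarith
      have h3 : -1 < n := by exact_mod_cast h1
      have h4 : n < 1 := by exact_mod_cast h2
      have : n = 0 := by omega
      subst this
      simp at hn
      linarith
    · obtain ⟨n, hn⟩ := key (x + y) (by push_cast; exact h)
      have h1 : (0 : ℝ) < n := by linarith
      have h2 : (n : ℝ) < 1 := by linarith
      have h3 : 0 < n := by exact_mod_cast h1
      have h4 : n < 1 := by exact_mod_cast h2
      omega
  refine ((Set.Ioo_infinite (by norm_num : (0 : ℝ) < 1 / 2)).image hinj).mono ?_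
  rintro _ ⟨x, hx, rfl⟩
  refine ⟨x, fun h => ?_, rfl⟩
  simp only [Set.mem_Ioo] at hx
  obtain ⟨n, hn⟩ := key (2 * x) (by push_cast; exact h)
  have h1 : (0 : ℝ) < n := by linarith
  have h2 : (n : ℝ) < 1 := by linarith
  have h3 : 0 < n := by exact_mod_cast h1
  have h4 : n < 1 := by exact_mod_cast h2
  omega

/-- The degree controls fibres only off a finite set, which cannot exhaust the infinitely many
non-orbifold points. -/
theorem HasDegree.exists_regular {u : Pillow Λ → Pillow Λ₀} {d : ℕ} (h : HasDegree u d) :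
    ∃ c : ℂ, 2 * c ∉ Λ₀ ∧ (u ⁻¹' {proj Λ₀ c}).encard = d := by
  obtain ⟨_, ⟨c, hc, rfl⟩, hy⟩ := infinite_proj_regular.exists_notMem_finite h
  exact ⟨c, hc, by simpa using hy⟩

theorem IsLinear.ne_zero {u : Pillow Λ → Pillow Λ₀} {ξ : ℂ} (hu : IsLinear u ξ) {d : ℕ}
    (hd : 1 ≤ d) (h : HasDegree u d) : ξ ≠ 0 := by
  rintro rfl
  obtain ⟨c, hc, he⟩ := h.exists_regular
  have hempty : u ⁻¹' {proj Λ₀ c} = ∅ := by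
    refine Set.eq_empty_of_forall_notMem fun x hx => hc ?_
    obtain ⟨w, rfl⟩ := proj_surjective x
    have hx : u (proj Λ w) = proj Λ₀ c := hx
    rw [hu, zero_mul, eq_comm] at hx
    have hc0 : c ∈ Λ₀ := by simpa [proj_eq_iff] using hx
    rw [two_mul]
    exact add_mem hc0 hc0
  rw [hempty, Set.encard_empty] at he
  have : d = 0 := by exact_mod_cast he.symm
  omega

theorem IsLinear.index_eq {u : Pillow Λ → Pillow Λ₀} {ξ : ℂ} (hu : IsLinear u ξ) {d : ℕ}
    (hd : 1 ≤ d) (h : HasDegree u d) :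
    Nat.card (Λ₀ ⧸ (Λ.map (LinearMap.mulLeft ℤ ξ)).submoduleOf Λ₀) = d := by
  obtain ⟨c, hc, he⟩ := h.exists_regular
  rw [hu.encard_fibre (hu.ne_zero hd h) hc] at he
  exact congrArg ENat.toNat he

/-! ### Orbifold points -/

/-- The orbifold point with given coordinates of its double. -/
noncomputable def halfPoint (E : Λ ≃ₗ[ℤ] (Fin 2 → ℤ)) (v : Fin 2 → ℤ) : Pillow Λ :=
  proj Λ ((E.symm v : ℂ) / 2)

/-- The involution acts trivially on `½Λ/Λ ≅ (ℤ/2)²`, because `v ≡ -v` modulo `2`. -/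
theorem halfPoint_eq_iff (E : Λ ≃ₗ[ℤ] (Fin 2 → ℤ)) {v v' : Fin 2 → ℤ} :
    halfPoint E v = halfPoint E v' ↔ ∀ i, (2 : ℤ) ∣ v i - v' i := by
  have key : ∀ v : Fin 2 → ℤ, (E.symm v : ℂ) / 2 ∈ Λ ↔ ∀ i, (2 : ℤ) ∣ v i := by
    intro v
    constructor
    · intro h i
      refine ⟨E ⟨_, h⟩ i, ?_⟩
      have : (2 : ℤ) • (⟨_, h⟩ : Λ) = E.symm v := by
        ext
        simp
        ring
      have h2 := congrArg E this
      rw [map_smul, E.apply_symm_apply] at h2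
      simpa using (congrFun h2 i).symm
    · intro h
      choose w hw using h
      have : v = (2 : ℤ) • w := by
        funext i
        simp [hw i]
      rw [this, map_smul]
      simp
  rw [halfPoint, halfPoint, proj_eq_iff]
  have e1 : (E.symm v : ℂ) / 2 - (E.symm v' : ℂ) / 2 = (E.symm (v - v') : ℂ) / 2 := by
    rw [map_sub]; push_cast; ring
  have e2 : (E.symm v : ℂ) / 2 + (E.symm v' : ℂ) / 2 = (E.symm (v + v') : ℂ) / 2 := by
    rw [map_add]; push_cast; ring
  rw [e1, e2, key, key]
  constructor
  · rintro (h | h) i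
    · exact h i
    · have := h i
      simp only [Pi.add_apply] at this
      omega
  · exact fun h => Or.inl h

/-- An enumeration of the four orbifold points. -/
noncomputable def halfPoints (E : Λ ≃ₗ[ℤ] (Fin 2 → ℤ)) (i : Fin 4) : Pillow Λ :=
  halfPoint E ((![![0, 0], ![1, 0], ![1, 1], ![0, 1]] : Fin 4 → Fin 2 → ℤ) i)

theorem halfPoints_injective (E : Λ ≃ₗ[ℤ] (Fin 2 → ℤ)) : Function.Injective (halfPoints E) := by
  intro i j h
  have := (halfPoint_eq_iff E).1 h
  fin_cases i <;> fin_cases j <;> simp [Fin.forall_fin_two] at this ⊢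

theorem halfPoints_zero (E : Λ ≃ₗ[ℤ] (Fin 2 → ℤ)) : halfPoints E 0 = proj Λ 0 := by
  have : (![0, 0] : Fin 2 → ℤ) = 0 := by ext i; fin_cases i <;> rfl
  simp [halfPoints, halfPoint, this]

theorem range_halfPoints (E : Λ ≃ₗ[ℤ] (Fin 2 → ℤ)) :
    Set.range (halfPoints E) = proj Λ '' {w : ℂ | 2 * w ∈ Λ} := by
  ext x
  constructor
  · rintro ⟨i, rfl⟩
    refine ⟨_, ?_, rfl⟩
    change 2 * (_ / 2) ∈ Λ
    rw [mul_div_cancel₀ _ two_ne_zero]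
    exact Subtype.coe_prop _
  · rintro ⟨w, hw, rfl⟩
    have hw : 2 * w ∈ Λ := hw
    have e : proj Λ w = halfPoint E (E ⟨_, hw⟩) := by
      simp [halfPoint]
    rw [e]
    generalize E ⟨_, hw⟩ = v
    have h0 := Int.emod_two_eq_zero_or_one (v 0)
    have h1 := Int.emod_two_eq_zero_or_one (v 1)
    rcases h0 with h0 | h0 <;> rcases h1 with h1 | h1
    · exact ⟨0, (halfPoint_eq_iff E).2 (by simp [Fin.forall_fin_two]; omega)⟩
    · exact ⟨3, (halfPoint_eq_iff E).2 (by simp [Fin.forall_fin_two]; omega)⟩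
    · exact ⟨1, (halfPoint_eq_iff E).2 (by simp [Fin.forall_fin_two]; omega)⟩
    · exact ⟨2, (halfPoint_eq_iff E).2 (by simp [Fin.forall_fin_two]; omega)⟩

theorem nonempty_equiv_of_isZLattice (Λ : Submodule ℤ ℂ) [DiscreteTopology Λ] [IsZLattice ℝ Λ] :
    Nonempty (Λ ≃ₗ[ℤ] (Fin 2 → ℤ)) := by
  have : Module.finrank ℤ Λ = 2 := by
    rw [ZLattice.rank ℝ Λ, Complex.finrank_real_complex]
  exact ⟨(Module.finBasisOfFinrankEq ℤ Λ this).equivFun⟩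

/-- Serves to show that the four markings are distinct, since their range is the four-element set of
orbifold points. -/
theorem injective_of_range_eq {α : Type*} {f g : Fin 4 → α} (h : Set.range f = Set.range g)
    (hg : Function.Injective g) : Function.Injective f := by
  have h1 : ∀ i, ∃ j, f j = g i := fun i => h.ge (Set.mem_range_self i)
  choose σ hσ using h1
  have hσi : Function.Injective σ := fun i j hij => hg (by rw [← hσ, ← hσ, hij])
  have hσs := Finite.surjective_of_injective hσi
  intro i j hij
  obtain ⟨i, rfl⟩ := hσs i
  obtain ⟨j, rfl⟩ := hσs j
  rw [hσ, hσ] at hij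
  rw [hg hij]

/-! ### The sublattice of a marked map -/

instance (s : MarkedMap) : DiscreteTopology s.Λ := s.discrete

instance (s : MarkedMap) : IsZLattice ℝ s.Λ := s.isZLattice

theorem PreModuli.holo (s : PreModuli d) : IsHolomorphic s.1.u := by
  obtain ⟨a, -, h⟩ := mem_preModuli.1 s.2
  exact h.holo

theorem PreModuli.degree (s : PreModuli d) : HasDegree s.1.u d := by
  obtain ⟨a, -, h⟩ := mem_preModuli.1 s.2
  exact h.degree

theorem PreModuli.z_zero (s : PreModuli d) : s.1.z 0 = proj s.1.Λ 0 := by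
  obtain ⟨a, -, h⟩ := mem_preModuli.1 s.2
  exact h.z_zero

theorem PreModuli.range_z (s : PreModuli d) :
    Set.range s.1.z = proj s.1.Λ '' {w : ℂ | 2 * w ∈ s.1.Λ} := by
  obtain ⟨a, -, h⟩ := mem_preModuli.1 s.2
  exact h.range_z

theorem PreModuli.map_zero (s : PreModuli d) : s.1.u (proj s.1.Λ 0) = proj Λ₀ 0 := by
  obtain ⟨a, ha, h⟩ := mem_preModuli.1 s.2
  rw [← h.z_zero, h.map_z, ha]
  rfl

theorem PreModuli.exists_linear (s : PreModuli d) : ∃ ξ, IsLinearLifting s.1 ξ :=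
  (PreModuli.holo s).exists_linear (PreModuli.map_zero s)

theorem PreModuli.z_injective (s : PreModuli d) : Function.Injective s.1.z := by
  obtain ⟨E⟩ := nonempty_equiv_of_isZLattice s.1.Λ
  exact injective_of_range_eq ((PreModuli.range_z s).trans (range_halfPoints E).symm)
    (halfPoints_injective E)

/-- The image of the lattice of the domain under a linear lifting. -/
noncomputable def PreModuli.lattice (s : PreModuli d) : Submodule ℤ ℂ :=
  s.1.Λ.map (LinearMap.mulLeft ℤ (PreModuli.exists_linear s).choose)

theorem map_mulLeft_eq_of_proj_mul {Λ Λ' : Submodule ℤ ℂ} [DiscreteTopology Λ'] {a b : ℂ}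
    (h : ∀ w, proj Λ' (a * w) = proj Λ' (b * w)) :
    Λ.map (LinearMap.mulLeft ℤ a) = Λ.map (LinearMap.mulLeft ℤ b) := by
  rcases eq_or_eq_neg_of_proj_mul h with rfl | rfl
  · rfl
  · exact map_mulLeft_neg b

theorem PreModuli.lattice_eq (s : PreModuli d) {ξ : ℂ} (hξ : IsLinearLifting s.1 ξ) :
    PreModuli.lattice s = s.1.Λ.map (LinearMap.mulLeft ℤ ξ) :=
  map_mulLeft_eq_of_proj_mul (Λ' := Λ₀) fun w => by
    rw [← hξ w, (PreModuli.exists_linear s).choose_spec w]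

theorem PreModuli.lattice_mem (hd : 1 ≤ d) (s : PreModuli d) :
    PreModuli.lattice s ∈ Sublattices d := by
  obtain ⟨ξ, hξ⟩ := PreModuli.exists_linear s
  have hl : IsLinear s.1.u ξ := hξ
  rw [PreModuli.lattice_eq s hξ]
  refine ⟨hl.map_le, ?_, hl.index_eq hd (PreModuli.degree s)⟩
  obtain ⟨E⟩ := nonempty_equiv_of_isZLattice s.1.Λ
  exact ⟨(Submodule.equivMapOfInjective _
    (mul_right_injective₀ (hl.ne_zero hd (PreModuli.degree s))) s.1.Λ).symm.trans E⟩

/-- An equivalence matches the first markings, so it lifts to some `η` with `ηΛ = Λ'`; then `ξ'η`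
lifts `u` and `ξ'ηΛ = ξ'Λ'`. -/
theorem PreModuli.lattice_congr {s s' : PreModuli d} (h : MarkedMap.Equivalent s.1 s'.1) :
    PreModuli.lattice s = PreModuli.lattice s' := by
  obtain ⟨φ, hu, hz⟩ := h
  obtain ⟨ξ', hξ'⟩ := PreModuli.exists_linear s'
  obtain ⟨η, hη, hm⟩ := φ.exists_linear (by rw [← PreModuli.z_zero s, hz, PreModuli.z_zero s'])
  have hl : IsLinear s'.1.u ξ' := hξ'
  have hξ : IsLinearLifting s.1 (ξ' * η) := by
    have := hl.comp hη
    rwa [← hu] at this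
  rw [PreModuli.lattice_eq s hξ, PreModuli.lattice_eq s' hξ', ← map_mulLeft_map, hm]

/-- The map `[u] ↦ Λ_u`. -/
noncomputable def theta (hd : 1 ≤ d) : Moduli d → Sublattices d :=
  Quotient.lift (fun s : PreModuli d => ⟨PreModuli.lattice s, PreModuli.lattice_mem hd s⟩)
    fun _ _ h => Subtype.ext (PreModuli.lattice_congr h)

theorem isTheta_theta (hd : 1 ≤ d) : IsTheta d (theta hd) :=
  fun s => ⟨PreModuli.exists_linear s, fun _ hξ => PreModuli.lattice_eq s hξ⟩

/-! ### Marked maps with the same sublattice -/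

theorem PreModuli.exists_biholo (hd : 1 ≤ d) {s s' : PreModuli d}
    (h : PreModuli.lattice s = PreModuli.lattice s') :
    ∃ (ψ : Biholo s.1.Λ s'.1.Λ) (τ : S₃), s.1.u = s'.1.u ∘ ψ.toEquiv ∧
      ∀ i, ψ.toEquiv (s.1.z i) = s'.1.z ((τ : Equiv.Perm (Fin 4)) i) := by
  obtain ⟨ξ, hξ⟩ := PreModuli.exists_linear s
  obtain ⟨ξ', hξ'⟩ := PreModuli.exists_linear s'
  rw [PreModuli.lattice_eq s hξ, PreModuli.lattice_eq s' hξ'] at h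
  have hl : IsLinear s.1.u ξ := hξ
  have hl' : IsLinear s'.1.u ξ' := hξ'
  have h0 := hl.ne_zero hd (PreModuli.degree s)
  have h0' := hl'.ne_zero hd (PreModuli.degree s')
  have hm : s.1.Λ.map (LinearMap.mulLeft ℤ (ξ'⁻¹ * ξ)) = s'.1.Λ := by
    rw [← map_mulLeft_map, h, map_mulLeft_map, inv_mul_cancel₀ h0', map_mulLeft_one]
  have hne : ξ'⁻¹ * ξ ≠ 0 := mul_ne_zero (inv_ne_zero h0') h0
  let ψ := Biholo.ofLinear hne hm
  have hψ : IsLinear ψ.toEquiv (ξ'⁻¹ * ξ) := Biholo.isLinear_ofLinear hne hm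
  have hrange : ∀ i, ∃ j, s'.1.z j = ψ.toEquiv (s.1.z i) := by
    intro i
    obtain ⟨w, hw, hwi⟩ := (PreModuli.range_z s).le (Set.mem_range_self i)
    refine (PreModuli.range_z s').ge ⟨ξ'⁻¹ * ξ * w, ?_, by rw [← hwi, hψ]⟩
    have := map_mulLeft_le_iff.1 hm.le _ hw
    change _ ∈ s'.1.Λ
    convert this using 1
    ring
  -- `σ` compares the two numberings; it is injective on four elements and fixes `0` because `ψ` is
  -- linear.
  choose σ hσ using hrange
  have hσi : Function.Injective σ := fun i j hij =>
    PreModuli.z_injective s (ψ.toEquiv.injective (by rw [← hσ, ← hσ, hij]))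
  have hσ0 : σ 0 = 0 := PreModuli.z_injective s' (by
    rw [hσ, PreModuli.z_zero s, PreModuli.z_zero s', hψ, mul_zero])
  refine ⟨ψ, ⟨Equiv.ofBijective σ (Finite.injective_iff_bijective.1 hσi), hσ0⟩, ?_,
    fun i => (hσ i).symm⟩
  funext x
  obtain ⟨w, rfl⟩ := proj_surjective x
  rw [hl, Function.comp_apply, hψ, hl']
  congr 1
  field_simp

theorem theta_smul (hd : 1 ≤ d) (τ : S₃) (m : Moduli d) : theta hd (τ • m) = theta hd m := by
  induction m using Quotient.inductionOn with
  | h s =>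
    apply Subtype.ext
    obtain ⟨ξ, hξ⟩ := PreModuli.exists_linear s
    have hξ' : IsLinearLifting (s.1.relabel τ) ξ := hξ
    exact (PreModuli.lattice_eq ⟨_, relabel_mem τ s.2⟩ hξ').trans (PreModuli.lattice_eq s hξ).symm

theorem exists_smul_eq (hd : 1 ≤ d) (m m' : Moduli d) (h : theta hd m = theta hd m') :
    ∃ τ : S₃, τ • m = m' := by
  induction m using Quotient.inductionOn with
  | h s =>
    induction m' using Quotient.inductionOn with
    | h s' =>
      obtain ⟨ψ, τ, hu, hz⟩ := PreModuli.exists_biholo hd (congrArg Subtype.val h)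
      refine ⟨τ, Quotient.sound ⟨ψ, hu, fun i => ?_⟩⟩
      change ψ.toEquiv (s.1.z ((τ : Equiv.Perm (Fin 4)).symm i)) = _
      rw [hz, Equiv.apply_symm_apply]

/-- The equivalence lifts to some `η` with `ξη = ±ξ`, so it is the identity on the quotient, and
distinctness of the markings forces `τ = 1`. -/
theorem eq_one_of_smul_eq (hd : 1 ≤ d) (τ : S₃) (m : Moduli d) (h : τ • m = m) : τ = 1 := by
  induction m using Quotient.inductionOn with
  | h s =>
    obtain ⟨φ, hu, hz⟩ := Quotient.exact h
    have hτ0 : (τ : Equiv.Perm (Fin 4)).symm 0 = 0 :=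
      (Equiv.symm_apply_eq _).2 (MulAction.mem_stabilizer_iff.1 τ.2).symm
    change Biholo s.1.Λ s.1.Λ at φ
    have hu : s.1.u = s.1.u ∘ φ.toEquiv := hu
    have hz : ∀ i, φ.toEquiv (s.1.z ((τ : Equiv.Perm (Fin 4)).symm i)) = s.1.z i := hz
    obtain ⟨η, hη, -⟩ := φ.exists_linear (by
      have := hz 0
      rwa [hτ0, PreModuli.z_zero s] at this)
    obtain ⟨ξ, hξ⟩ := PreModuli.exists_linear s
    have hl : IsLinear s.1.u ξ := hξ
    have h0 := hl.ne_zero hd (PreModuli.degree s)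
    have hη1 : η = 1 ∨ η = -1 := by
      have h1 : ξ * η = ξ ∨ ξ * η = -ξ := eq_or_eq_neg_of_proj_mul (Λ := Λ₀) fun w => by
        rw [← hl w, ← (hl.comp hη) w, ← hu]
      refine h1.imp (fun h => mul_left_cancel₀ h0 ?_) fun h => mul_left_cancel₀ h0 ?_
      · rw [h, mul_one]
      · rw [h, mul_neg_one]
    have hid := hη.eq_id hη1
    refine Subtype.ext (Equiv.ext fun i => ?_)
    have h2 := hz ((τ : Equiv.Perm (Fin 4)) i)
    rw [hid, Equiv.symm_apply_apply] at h2
    exact (PreModuli.z_injective s h2).symm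

theorem existsUnique_smul_eq (hd : 1 ≤ d) (m m' : Moduli d) (h : theta hd m = theta hd m') :
    ∃! τ : S₃, τ • m = m' := by
  obtain ⟨τ, hτ⟩ := exists_smul_eq hd m m' h
  refine ⟨τ, hτ, fun σ hσ => ?_⟩
  have : (τ⁻¹ * σ) • m = m := by
    rw [mul_smul, hσ, ← hτ, inv_smul_smul]
  exact (inv_mul_eq_one.1 (eq_one_of_smul_eq hd _ m this)).symm

/-! ### Every sublattice occurs -/

theorem mem_Λ₀_iff {z : ℂ} : z ∈ Λ₀ ↔ ∃ m n : ℤ, (m : ℂ) + n * Complex.I = z := by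
  simp [Λ₀, Submodule.mem_span_pair]

theorem exists_xPt {w : ℂ} (hw : 2 * w ∈ Λ₀) : ∃ j, proj Λ₀ w = xPt j := by
  obtain ⟨m, n, h⟩ := mem_Λ₀_iff.1 hw
  have hw' : w = (m + n * Complex.I) / 2 := by rw [h]; ring
  obtain ⟨m', hm⟩ := Int.even_or_odd' m
  obtain ⟨n', hn⟩ := Int.even_or_odd' n
  have key : ∀ e : ℂ, w - e = m' + n' * Complex.I → proj Λ₀ w = proj Λ₀ e :=
    fun e he => proj_eq_iff.2 (Or.inl (mem_Λ₀_iff.2 ⟨m', n', he.symm⟩))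
  rcases hm with rfl | rfl <;> rcases hn with rfl | rfl
  · exact ⟨0, key 0 (by rw [hw']; push_cast; ring)⟩
  · exact ⟨3, key _ (by rw [hw']; push_cast; ring)⟩
  · exact ⟨1, key _ (by rw [hw']; push_cast; ring)⟩
  · exact ⟨2, key _ (by rw [hw']; push_cast; ring)⟩

theorem Sublattices.discreteTopology {L : Submodule ℤ ℂ} (hL : L ∈ Sublattices d) :
    DiscreteTopology L :=
  DiscreteTopology.of_subset discreteTopology_Λ₀ hL.1

/-- The index `d` annihilates `Λ₀ / L`, so `dΛ₀ ⊆ L` and the real span of `L` contains `Λ₀`. -/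
theorem Sublattices.isZLattice (hd : 1 ≤ d) {L : Submodule ℤ ℂ} (hL : L ∈ Sublattices d)
    [DiscreteTopology L] : IsZLattice ℝ L where
  span_top := by
    rw [eq_top_iff, ← isZLattice_Λ₀.span_top, Submodule.span_le]
    intro x hx
    have h1 : d • (Submodule.Quotient.mk ⟨x, hx⟩ : Λ₀ ⧸ L.submoduleOf Λ₀) = 0 := by
      rw [← hL.2.2]
      exact card_nsmul_eq_zero'
    rw [← Submodule.Quotient.mk_smul, Submodule.Quotient.mk_eq_zero] at h1
    have h2 : d • x ∈ L := h1
    have hd0 : (d : ℝ) ≠ 0 := by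
      have : d ≠ 0 := by omega
      exact_mod_cast this
    have h3 : x = (d : ℝ)⁻¹ • (d • x) := by
      rw [← Nat.cast_smul_eq_nsmul ℝ, inv_smul_smul₀ hd0]
    rw [h3]
    exact Submodule.smul_mem _ _ (Submodule.subset_span h2)

theorem IsLinear.hasDegree {Λ : Submodule ℤ ℂ} {u : Pillow Λ → Pillow Λ₀} {ξ : ℂ}
    (hu : IsLinear u ξ) (hξ : ξ ≠ 0) (hd : 1 ≤ d)
    (h : Nat.card (Λ₀ ⧸ (Λ.map (LinearMap.mulLeft ℤ ξ)).submoduleOf Λ₀) = d) :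
    HasDegree u d := by
  refine (Set.finite_range xPt).subset fun y hy => ?_
  obtain ⟨c, rfl⟩ := proj_surjective y
  by_contra hc
  refine hy ?_
  have hreg : 2 * c ∉ Λ₀ := fun h => hc ((exists_xPt h).imp fun _ => Eq.symm)
  -- `Nat.card` is `0` on infinite types, so `d ≥ 1` is what makes the quotient finite.
  have : Finite (Λ₀ ⧸ (Λ.map (LinearMap.mulLeft ℤ ξ)).submoduleOf Λ₀) :=
    Nat.finite_of_card_ne_zero (by omega)
  rw [hu.encard_fibre hξ hreg, ENat.card_eq_coe_natCard, h]

theorem theta_surjective (hd : 1 ≤ d) : Function.Surjective (theta hd) := by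
  rintro ⟨L, hL⟩
  have hdisc := Sublattices.discreteTopology hL
  have hlat := Sublattices.isZLattice hd hL
  obtain ⟨E⟩ := hL.2.1
  have hu : IsLinear (linearMap L Λ₀ 1) 1 :=
    isLinear_linearMap (by rw [map_mulLeft_one]; exact hL.1)
  have hdeg : HasDegree (linearMap L Λ₀ 1) d :=
    hu.hasDegree one_ne_zero hd (by rw [map_mulLeft_one]; exact hL.2.2)
  -- The insertions are read off from the inclusion; the clause on `0` secures that the first one is
  -- `x₁`.
  have ha : ∀ i, ∃ j, linearMap L Λ₀ 1 (halfPoints E i) = xPt j ∧ (i = 0 → j = 0) := by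
    intro i
    by_cases hi : i = 0
    · refine ⟨0, ?_, fun _ => rfl⟩
      rw [hi, halfPoints_zero, hu, mul_zero]
      rfl
    · obtain ⟨w, hw, hwi⟩ := (range_halfPoints E).le (Set.mem_range_self i)
      rw [← hwi, hu, one_mul]
      obtain ⟨j, hj⟩ := exists_xPt (hL.1 hw)
      exact ⟨j, hj, fun h => absurd h hi⟩
  choose a ha ha0 using ha
  let s : PreModuli d := ⟨⟨L, hdisc, hlat, linearMap L Λ₀ 1, halfPoints E⟩,
    mem_preModuli.2 ⟨a, ha0 0 rfl, hu.isHolomorphic, hdeg, range_halfPoints E, halfPoints_zero E,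
      ha, fun i => hu.isInjectiveOnLocalGroup _⟩⟩
  refine ⟨Moduli.mk s, Subtype.ext ?_⟩
  exact (PreModuli.lattice_eq s (ξ := 1) hu).trans map_mulLeft_one

theorem card_S₃ : Nat.card S₃ = 6 := by
  rw [Nat.card_eq_fintype_card]
  decide

theorem ncard_fibre_theta (hd : 1 ≤ d) (L : Sublattices d) : (theta hd ⁻¹' {L}).ncard = 6 := by
  obtain ⟨m, rfl⟩ := theta_surjective hd L
  have hinj : Function.Injective fun τ : S₃ => τ • m := fun σ τ h =>
    (existsUnique_smul_eq hd m (τ • m) (theta_smul hd τ m).symm).unique h rfl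
  have hr : theta hd ⁻¹' {theta hd m} = Set.range fun τ : S₃ => τ • m := by
    ext m'
    constructor
    · exact fun h => exists_smul_eq hd m m' (Eq.symm h)
    · rintro ⟨τ, rfl⟩
      exact theta_smul hd τ m
  rw [hr, ← Set.image_univ, Set.ncard_image_of_injective _ hinj, Set.ncard_univ, card_S₃]

end Pillowcase

theorem mainTheorem3 (d : ℕ) (hd : 1 ≤ d) :
    ∃ Θ : Pillowcase.Moduli d → Pillowcase.Sublattices d,
      Pillowcase.IsTheta d Θ ∧
      Function.Surjective Θ ∧
      (∀ L : Pillowcase.Sublattices d, (Θ ⁻¹' {L}).ncard = 6) ∧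
      (∀ s s' : Pillowcase.PreModuli d,
        Θ (Pillowcase.Moduli.mk s) = Θ (Pillowcase.Moduli.mk s') →
          ∃ (ψ : Pillowcase.Biholo s.1.Λ s'.1.Λ) (τ : Pillowcase.S₃),
            s.1.u = s'.1.u ∘ ψ.toEquiv ∧
            ∀ i, ψ.toEquiv (s.1.z i) = s'.1.z ((τ : Equiv.Perm (Fin 4)) i)) ∧
      (∀ (τ : Pillowcase.S₃) (m : Pillowcase.Moduli d), Θ (τ • m) = Θ m) ∧
      (∀ m m' : Pillowcase.Moduli d, Θ m = Θ m' → ∃! τ : Pillowcase.S₃, τ • m = m') :=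
  ⟨Pillowcase.theta hd, Pillowcase.isTheta_theta hd, Pillowcase.theta_surjective hd,
    Pillowcase.ncard_fibre_theta hd,
    fun _ _ h => Pillowcase.PreModuli.exists_biholo hd (congrArg Subtype.val h),
    Pillowcase.theta_smul hd, Pillowcase.existsUnique_smul_eq hd⟩
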